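/- Let $(\Omega,\mathcal F,(\mathcal F_t)_{t\ge 0},\mathbb P)$ be a filtered probability space and let $\varepsilon>0$. Let $M=(M_t)_{t\ge 0}$ be a real-valued Lévy process ($M_0=0$ a.s., stationary independent increments, stochastically continuous, a.s. càdlàg paths) which is an $(\mathcal F_t)$-martingale, whose jumps satisfy, almost surely, $|\Delta M_t|\le\varepsilon$ for all $t\ge 0$, and whose predictable quadratic variation is $\langle M,M\rangle_t=\sigma_\varepsilon^2 t$ for all $t\ge0$. Let $\mu\in\mathbb R$, $\eta>0$, and let $0<t<\eta/(\mu\vee 0)$, where the fraction is $+\infty$ if $\mu\le 0$. Then: (1) $$\mathbb P\Big(\sup_{0\le s\le t}(M_s+\mu s)\ge\eta\Big)\le t^{\eta/\varepsilon}\,\bar C_0(\eta,\varepsilon;\mu),\qquad \bar C_0(\eta,\varepsilon;\mu)=\exp\Big(\frac{\mu\vee 0}{\varepsilon}\,e^{-1}\Big)\exp\Big(\frac{\sigma_\varepsilon^2}{\varepsilon^2}\Big).$$ (2) If either (i) $\mu\le 0$, or (ii) $\mu>0$ and $\eta\le\sigma_\varepsilon^2/\varepsilon$, then $$\mathbb P\Big(\sup_{0\le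 s\le t}(M_s+\mu s)\ge\eta\Big)\le t^{\eta/\varepsilon}\,\bar C_1(\eta,\varepsilon;\mu),\qquad \bar C_1(\eta,\varepsilon;\mu)=\exp\Big(\frac{\mu\vee 0}{\varepsilon}\,e^{-1}\Big)\Big(\frac{e\,\sigma_\varepsilon^2}{\varepsilon\,\eta}\Big)^{\eta/\varepsilon}.$$ -/

import Mathlib

open MeasureTheory ProbabilityTheory Filter Topology Set
open scoped NNReal

/-- A real path indexed by `[0, ∞)` is càdlàg: right-continuous with (finite) left limits. At time
`0` the left-limit condition is void. -/
def IsCadlagPath (f : ℝ≥0 → ℝ) : Prop :=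
  ∀ t : ℝ≥0, ContinuousWithinAt f (Ici t) t ∧ ∃ l : ℝ, Tendsto f (𝓝[<] t) (𝓝 l)

/-- The jump `Δf(t) = f(t) - f(t-)` of a path at time `t` (for a càdlàg path, `Δf(0) = 0`). -/
noncomputable def pathJump (f : ℝ≥0 → ℝ) (t : ℝ≥0) : ℝ :=
  f t - Function.leftLim f t

/-- A real-valued Lévy process: it starts at `0`, has independent and stationary increments, is
stochastically continuous, and has càdlàg paths almost surely. -/
structure IsLevyProcess {Ω : Type*} [MeasurableSpace Ω] (X : ℝ≥0 → Ω → ℝ) (P : Measure Ω) :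
    Prop where
  start_zero : ∀ᵐ ω ∂P, X 0 ω = 0
  indep_increments : HasIndepIncrements X P
  stationary_increments : ∀ s t : ℝ≥0, IdentDistrib (fun ω => X (s + t) ω - X s ω) (X t) P P
  stoch_continuous : ∀ t : ℝ≥0, TendstoInMeasure P X (𝓝 t) (X t)
  cadlag : ∀ᵐ ω ∂P, IsCadlagPath (fun t => X t ω)

/-- `A` is the predictable (angle) bracket `⟨M, M⟩` of the square-integrable martingale `M` with
respect to the filtration `ℱ`: `A` is predictable, integrable, starts at `0`, has nondecreasing
right-continuous paths, and `M² - A` is a martingale. -/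
structure IsAngleBracket {Ω : Type*} {mΩ : MeasurableSpace Ω} (M A : ℝ≥0 → Ω → ℝ)
    (ℱ : Filtration ℝ≥0 mΩ) (P : Measure Ω) : Prop where
  predictable : IsStronglyPredictable ℱ A
  integrable : ∀ t, Integrable (A t) P
  start_zero : ∀ᵐ ω ∂P, A 0 ω = 0
  monotone : ∀ᵐ ω ∂P, Monotone (fun t => A t ω)
  right_continuous : ∀ᵐ ω ∂P, ∀ t, ContinuousWithinAt (fun s => A s ω) (Ici t) t
  martingale : Martingale (fun t ω => (M t ω) ^ 2 - A t ω) ℱ P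

/-- The constant `C̄₀(η, ε; μ) = exp((μ ∨ 0) e⁻¹ / ε) exp(σ² / ε²)` (it does not depend on `η`). -/
noncomputable def CBarZero (σ ε μ : ℝ) : ℝ :=
  Real.exp (max μ 0 / ε * Real.exp (-1)) * Real.exp (σ ^ 2 / ε ^ 2)

/-- The constant `C̄₁(η, ε; μ) = exp((μ ∨ 0) e⁻¹ / ε) (e σ² / (ε η)) ^ (η / ε)`. -/
noncomputable def CBarOne (σ η ε μ : ℝ) : ℝ :=
  Real.exp (max μ 0 / ε * Real.exp (-1)) * (Real.exp 1 * σ ^ 2 / (ε * η)) ^ (η / ε)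

/-! The argument is Chernoff's method: bound `E exp(l M_t)` by `exp(σ² t · bennettRate ε l)`, pass
to the supremum by Doob's inequality, and choose `l`.

The moment bound (`lintegral_exp_le`) avoids stochastic calculus. `M_t` is a sum of i.i.d. centred
grid increments with total variance `σ² t`. Truncated above at some `c > ε`, each satisfies
Bennett's inequality, and independence multiplies the bounds. Since jumps are at most `ε`, almost
every path has no increment above `c` once the mesh is fine, so truncation eventually changes
nothing. Fatou's lemma and then `c ↓ ε` conclude.

The drift costs at most `(μ ∨ 0) t` in the level. Taking `exp (l ε) = 1 / t` gives `CBarZero`, and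
`exp (l ε) = ε η / (σ² t)` gives `CBarOne`. Where these would make `l` negative, the claimed bound
is at least `1`. -/

/-! ### Bennett's elementary inequality -/

/-- The rate `∫₀¹ (1 - s) exp (l c s) ds · l² = (exp (l c) - 1 - l c) / c²` of Bennett's
inequality, for jumps bounded by `c`. -/
noncomputable def bennettRate (c l : ℝ) : ℝ :=
  (Real.exp (l * c) - 1 - l * c) / c ^ 2

theorem exp_sub_one_sub_eq_integral (x : ℝ) :
    Real.exp x - 1 - x = x ^ 2 * ∫ s in (0 : ℝ)..1, (1 - s) * Real.exp (s * x) := by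
  have h : ∀ s ∈ uIcc (0 : ℝ) 1,
      HasDerivAt (fun s => x * (1 - s) * Real.exp (s * x) + Real.exp (s * x))
        (x ^ 2 * ((1 - s) * Real.exp (s * x))) s := by
    intro s _
    have h1 : HasDerivAt (fun s : ℝ => Real.exp (s * x)) (Real.exp (s * x) * (1 * x)) s :=
      ((hasDerivAt_id s).mul_const x).exp
    have h2 : HasDerivAt (fun s : ℝ => x * (1 - s)) (x * -1) s :=
      ((hasDerivAt_id s).const_sub 1).const_mul x
    exact ((h2.mul h1).add h1).congr_deriv (by ring)
  have hi := intervalIntegral.integral_eq_sub_of_hasDerivAt h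
    (Continuous.intervalIntegrable (by fun_prop) _ _)
  rw [intervalIntegral.integral_const_mul] at hi
  rw [hi]
  simp
  ring

/-- The integral remainder shows that `(exp x - 1 - x) / x²` increases with `x`, so an upper bound
on `y` suffices, with no lower bound. -/
theorem exp_le_one_add_add_sq_mul_bennettRate {c l y : ℝ} (hc : 0 < c) (hl : 0 ≤ l)
    (hy : y ≤ c) : Real.exp (l * y) ≤ 1 + l * y + y ^ 2 * bennettRate c l := by
  have hm : ∫ s in (0 : ℝ)..1, (1 - s) * Real.exp (s * (l * y)) ≤
      ∫ s in (0 : ℝ)..1, (1 - s) * Real.exp (s * (l * c)) := by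
    refine intervalIntegral.integral_mono_on zero_le_one
      (Continuous.intervalIntegrable (by fun_prop) _ _)
      (Continuous.intervalIntegrable (by fun_prop) _ _) fun s hs => ?_
    have h0 := hs.1
    have h1 : 0 ≤ 1 - s := sub_nonneg.2 hs.2
    gcongr
  have hb : bennettRate c l = l ^ 2 * ∫ s in (0 : ℝ)..1, (1 - s) * Real.exp (s * (l * c)) := by
    rw [bennettRate, exp_sub_one_sub_eq_integral]
    field_simp
  have hx := exp_sub_one_sub_eq_integral (l * y)
  have := mul_le_mul_of_nonneg_left hm (sq_nonneg (l * y))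
  rw [hb]
  linarith [mul_pow l y 2, show y ^ 2 * (l ^ 2 * ∫ s in (0 : ℝ)..1, (1 - s) * Real.exp (s * (l * c)))
    = (l * y) ^ 2 * ∫ s in (0 : ℝ)..1, (1 - s) * Real.exp (s * (l * c)) by ring]

theorem bennettRate_nonneg {c l : ℝ} : 0 ≤ bennettRate c l :=
  div_nonneg (by linarith [Real.add_one_le_exp (l * c)]) (sq_nonneg c)

/-! ### Càdlàg paths on fine grids -/

/-- Near `x` the path is almost constant on each side, so only a pair straddling `x` sees a real
increment: the jump at `x` plus two errors of `(c - ε) / 2`. -/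
theorem IsCadlagPath.exists_nhds_sub_le {f : ℝ≥0 → ℝ} (hf : IsCadlagPath f) {ε c : ℝ}
    (hε : 0 ≤ ε) (hJ : ∀ t, |pathJump f t| ≤ ε) (hc : ε < c) (x : ℝ≥0) :
    ∃ U ∈ 𝓝 x, ∀ u ∈ U, ∀ v ∈ U, u ≤ v → f v - f u ≤ c := by
  obtain ⟨hr, l, hl⟩ := hf x
  have hd : 0 < (c - ε) / 2 := by linarith
  have hright : ∀ᶠ u in 𝓝[≥] x, |f u - f x| < (c - ε) / 2 := by
    simpa [Real.dist_eq] using Metric.tendsto_nhds.1 hr _ hd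
  have hleft : ∀ᶠ u in 𝓝[<] x, |f u - l| < (c - ε) / 2 := by
    simpa [Real.dist_eq] using Metric.tendsto_nhds.1 hl _ hd
  refine ⟨_, inter_mem (eventually_nhdsWithin_iff.1 hright) (eventually_nhdsWithin_iff.1 hleft),
    fun u hu v hv huv => ?_⟩
  rcases lt_or_ge u x with hux | hux
  · have h1 := abs_lt.1 (hu.2 hux)
    rcases lt_or_ge v x with hvx | hvx
    · have h2 := abs_lt.1 (hv.2 hvx)
      linarith
    · have h2 := abs_lt.1 (hv.1 hvx)
      -- `leftLim` is the left limit only where `𝓝[<] x` is nontrivial, which the point `u < x`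
      -- ensures.
      have := nhdsLT_neBot_of_exists_lt ⟨u, hux⟩
      have h3 := (abs_le.1 (hJ x)).2
      rw [pathJump, leftLim_eq_of_tendsto hl] at h3
      linarith
  · have h1 := abs_lt.1 (hu.1 hux)
    have h2 := abs_lt.1 (hv.1 (hux.trans huv))
    linarith

/-- Compactness of `[0, T]` makes the local bound uniform; `ρ` is a Lebesgue number of the cover. -/
theorem IsCadlagPath.exists_mesh_sub_le {f : ℝ≥0 → ℝ} (hf : IsCadlagPath f) {ε c : ℝ}
    (hε : 0 ≤ ε) (hJ : ∀ t, |pathJump f t| ≤ ε) (hc : ε < c) (T : ℝ≥0) :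
    ∃ ρ > 0, ∀ u ≤ T, ∀ v, u ≤ v → dist v u < ρ → f v - f u ≤ c := by
  choose U hU hfU using hf.exists_nhds_sub_le hε hJ hc
  obtain ⟨ρ, hρ, h⟩ := lebesgue_number_lemma_of_metric (s := Icc 0 T)
    (c := fun x => interior (U x)) isCompact_Icc (fun _ => isOpen_interior)
    fun x _ => mem_iUnion.2 ⟨x, mem_interior_iff_mem_nhds.2 (hU x)⟩
  refine ⟨ρ, hρ, fun u hu v huv hd => ?_⟩
  obtain ⟨i, hi⟩ := h u ⟨zero_le, hu⟩
  exact hfU i u (interior_subset (hi (Metric.mem_ball_self hρ))) v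
    (interior_subset (hi hd)) huv

/-- The `k`-th point of the equidistant partition of `[0, t]` into `n + 1` intervals. -/
noncomputable def gridPoint (t : ℝ≥0) (n k : ℕ) : ℝ≥0 :=
  k * (t / (n + 1))

theorem gridPoint_mono (t : ℝ≥0) (n : ℕ) : Monotone (gridPoint t n) := fun a b h => by
  unfold gridPoint
  gcongr

theorem gridPoint_zero (t : ℝ≥0) (n : ℕ) : gridPoint t n 0 = 0 := by simp [gridPoint]

theorem gridPoint_last (t : ℝ≥0) (n : ℕ) : gridPoint t n (n + 1) = t := by
  unfold gridPoint
  push_cast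
  field_simp

theorem gridPoint_succ (t : ℝ≥0) (n k : ℕ) :
    gridPoint t n (k + 1) = gridPoint t n k + t / (n + 1) := by
  unfold gridPoint
  push_cast
  ring

theorem tendsto_mesh (t : ℝ≥0) : Tendsto (fun n : ℕ => (t : ℝ) / (n + 1)) atTop (𝓝 0) := by
  have := (tendsto_one_div_add_atTop_nhds_zero_nat (𝕜 := ℝ)).const_mul (t : ℝ)
  simpa only [mul_one_div, mul_zero] using this

theorem IsCadlagPath.eventually_grid_sub_le {f : ℝ≥0 → ℝ} (hf : IsCadlagPath f) {ε c : ℝ}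
    (hε : 0 ≤ ε) (hJ : ∀ t, |pathJump f t| ≤ ε) (hc : ε < c) (t : ℝ≥0) :
    ∀ᶠ n in atTop, ∀ k < n + 1, f (gridPoint t n (k + 1)) - f (gridPoint t n k) ≤ c := by
  obtain ⟨ρ, hρ, h⟩ := hf.exists_mesh_sub_le hε hJ hc t
  filter_upwards [(tendsto_mesh t).eventually_lt_const hρ] with n hn k hk
  refine h _ ?_ _ (gridPoint_mono t n k.le_succ) ?_
  · exact (gridPoint_mono t n hk.le).trans (gridPoint_last t n).le
  · rw [gridPoint_succ, NNReal.dist_eq]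
    push_cast
    rw [add_sub_cancel_left, abs_of_nonneg (by positivity)]
    exact hn

/-- A right-continuous path exceeding a level on `[0, t]` eventually exceeds it on the grids. -/
theorem IsCadlagPath.eventually_exists_grid_lt {f : ℝ≥0 → ℝ} (hf : IsCadlagPath f)
    {t s : ℝ≥0} (ht : 0 < t) (hs : s ≤ t) {a : ℝ} (ha : a < f s) :
    ∀ᶠ n in atTop, ∃ k ≤ n + 1, a < f (gridPoint t n k) := by
  have hev := (hf s).1.eventually_const_lt ha
  obtain ⟨ρ, hρ, h⟩ := Metric.mem_nhdsWithin_iff.1 hev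
  filter_upwards [(tendsto_mesh t).eventually_lt_const hρ] with n hn
  have ht' : (0 : ℝ≥0) < t / (n + 1) := by positivity
  -- The first grid point at or after `s` lies within one mesh of it, on the side where
  -- right-continuity applies.
  have hle : s ≤ gridPoint t n ⌈s / (t / (n + 1))⌉₊ := by
    have := Nat.le_ceil (s / (t / (n + 1)))
    rwa [div_le_iff₀ ht'] at this
  refine ⟨⌈s / (t / (n + 1))⌉₊, ?_, h ⟨?_, hle⟩⟩
  · refine Nat.ceil_le.2 ((div_le_iff₀ ht').2 ?_)
    exact hs.trans (gridPoint_last t n).ge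
  · have hlt : gridPoint t n ⌈s / (t / (n + 1))⌉₊ < s + t / (n + 1) := by
      have := mul_lt_mul_of_pos_right (Nat.ceil_lt_add_one (zero_le (a := s / (t / (n + 1))))) ht'
      rwa [add_mul, one_mul, div_mul_cancel₀ _ ht'.ne'] at this
    rw [Metric.mem_ball, NNReal.dist_eq, abs_of_nonneg (sub_nonneg.2 (mod_cast hle))]
    have : (gridPoint t n ⌈s / (t / (n + 1))⌉₊ : ℝ) < s + t / (n + 1) := mod_cast hlt
    linarith

/-! ### Exponential moments -/

/-- Replace the values above `c` by `0`. -/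
noncomputable def truncAbove (c x : ℝ) : ℝ := if x ≤ c then x else 0

theorem measurable_truncAbove (c : ℝ) : Measurable (truncAbove c) :=
  Measurable.ite measurableSet_Iic measurable_id measurable_const

/-- Bennett's bound for a centred variable truncated from above. -/
theorem lintegral_exp_truncAbove_le {Ω : Type*} {mΩ : MeasurableSpace Ω} {P : Measure Ω}
    [IsProbabilityMeasure P] {X : Ω → ℝ} {c l v : ℝ} (hc : 0 < c) (hl : 0 ≤ l)
    (hX : Integrable X P) (hX2 : Integrable (fun ω => X ω ^ 2) P)
    (hmean : ∫ ω, X ω ∂P = 0) (hvar : ∫ ω, X ω ^ 2 ∂P = v) :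
    ∫⁻ ω, ENNReal.ofReal (Real.exp (l * truncAbove c (X ω))) ∂P ≤
      ENNReal.ofReal (Real.exp (v * bennettRate c l)) := by
  have hb : 0 ≤ bennettRate c l := bennettRate_nonneg
  have hpt : ∀ x : ℝ, Real.exp (l * truncAbove c x) ≤ 1 + l * x + x ^ 2 * bennettRate c l := by
    intro x
    unfold truncAbove
    split_ifs with h
    · exact exp_le_one_add_add_sq_mul_bennettRate hc hl h
    -- A truncated value contributes `exp 0 = 1`, and the right side is at least `1` because `x > c
    -- > 0`; the untruncated mean and variance can therefore be kept.
    · have hx : 0 ≤ x := hc.le.trans (not_le.1 h).le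
      have : 0 ≤ l * x + x ^ 2 * bennettRate c l := by positivity
      simp only [mul_zero, Real.exp_zero]
      linarith
  have hint : Integrable (fun ω => 1 + l * X ω + X ω ^ 2 * bennettRate c l) P :=
    ((integrable_const _).add (hX.const_mul l)).add (hX2.mul_const _)
  calc ∫⁻ ω, ENNReal.ofReal (Real.exp (l * truncAbove c (X ω))) ∂P
      ≤ ∫⁻ ω, ENNReal.ofReal (1 + l * X ω + X ω ^ 2 * bennettRate c l) ∂P :=
        lintegral_mono fun ω => ENNReal.ofReal_le_ofReal (hpt _)
    _ = ENNReal.ofReal (∫ ω, (1 + l * X ω + X ω ^ 2 * bennettRate c l) ∂P) :=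
        (ofReal_integral_eq_lintegral_ofReal hint
          (.of_forall fun ω => (Real.exp_pos _).le.trans (hpt _))).symm
    _ ≤ _ := by
        refine ENNReal.ofReal_le_ofReal ?_
        rw [integral_add (f := fun ω => 1 + l * X ω)
            ((integrable_const _).add (hX.const_mul l)) (hX2.mul_const _),
          integral_add (integrable_const _) (hX.const_mul l), integral_const_mul,
          integral_mul_const, hmean, hvar]
        simp only [integral_const, probReal_univ, smul_eq_mul]
        linarith [Real.add_one_le_exp (v * bennettRate c l)]

theorem tendsto_bennettRate {ε : ℝ} (hε : 0 < ε) (l : ℝ) :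
    Tendsto (fun c => bennettRate c l) (𝓝[>] ε) (𝓝 (bennettRate ε l)) := by
  have : ContinuousAt (fun c => bennettRate c l) ε := by
    unfold bennettRate
    exact ContinuousAt.div (by fun_prop) (by fun_prop) (by positivity)
  exact this.tendsto.mono_left nhdsWithin_le_nhds

theorem MeasureTheory.Martingale.integral_eq {Ω : Type*} {mΩ : MeasurableSpace Ω} {P : Measure Ω}
    [IsProbabilityMeasure P] {ℱ : Filtration ℝ≥0 mΩ} {M : ℝ≥0 → Ω → ℝ} (hM : Martingale M ℱ P)
    {s t : ℝ≥0} (h : s ≤ t) : ∫ ω, M t ω ∂P = ∫ ω, M s ω ∂P := by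
  simpa using (hM.setIntegral_eq h MeasurableSet.univ).symm

theorem IsAngleBracket.integrable_sq {Ω : Type*} {mΩ : MeasurableSpace Ω} {P : Measure Ω}
    {ℱ : Filtration ℝ≥0 mΩ} {M : ℝ≥0 → Ω → ℝ} {σ : ℝ}
    (hB : IsAngleBracket M (fun t _ => σ ^ 2 * (t : ℝ)) ℱ P)
    (t : ℝ≥0) : Integrable (fun ω => M t ω ^ 2) P := by
  refine ((hB.martingale.integrable t).add (hB.integrable t)).congr (.of_forall fun ω => ?_)
  simp

section Bracket

variable {Ω : Type*} {mΩ : MeasurableSpace Ω} {P : Measure Ω} [IsProbabilityMeasure P]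
  {ℱ : Filtration ℝ≥0 mΩ} {M : ℝ≥0 → Ω → ℝ} {ε σ : ℝ}

theorem IsAngleBracket.integral_sq (hB : IsAngleBracket M (fun t _ => σ ^ 2 * (t : ℝ)) ℱ P)
    (h0 : ∀ᵐ ω ∂P, M 0 ω = 0) (t : ℝ≥0) : ∫ ω, M t ω ^ 2 ∂P = σ ^ 2 * t := by
  have h := hB.martingale.integral_eq (zero_le (a := t))
  rw [integral_sub (hB.integrable_sq t) (hB.integrable t)] at h
  have hz : ∫ ω, (M 0 ω ^ 2 - σ ^ 2 * ((0 : ℝ≥0) : ℝ)) ∂P = 0 := by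
    rw [← integral_zero Ω ℝ]
    refine integral_congr_ae ?_
    filter_upwards [h0] with ω hω
    simp [hω]
  rw [hz] at h
  simp only [integral_const, probReal_univ, smul_eq_mul, one_mul] at h
  linarith

/-- The strict gap `ε < c` is what makes all grid increments at most `c` for a fine mesh, at a
threshold depending on the path; Fatou's lemma tolerates this lack of uniformity. -/
theorem IsLevyProcess.lintegral_exp_le_of_lt (hε : 0 < ε) (hLevy : IsLevyProcess M P)
    (hMart : Martingale M ℱ P)
    (hJump : ∀ᵐ ω ∂P, ∀ t : ℝ≥0, |pathJump (fun s => M s ω) t| ≤ ε)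
    (hB : IsAngleBracket M (fun t _ => σ ^ 2 * (t : ℝ)) ℱ P) {c l : ℝ} (hc : ε < c)
    (hl : 0 ≤ l) (t : ℝ≥0) :
    ∫⁻ ω, ENNReal.ofReal (Real.exp (l * M t ω)) ∂P ≤
      ENNReal.ofReal (Real.exp (σ ^ 2 * t * bennettRate c l)) := by
  have hmeas : ∀ s, Measurable (M s) := fun s =>
    ((hMart.stronglyMeasurable s).mono (ℱ.le s)).measurable
  let e : ℝ → ENNReal := fun x => ENNReal.ofReal (Real.exp (l * truncAbove c x))
  have he : Measurable e :=
    ENNReal.measurable_ofReal.comp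
      (Real.measurable_exp.comp ((measurable_truncAbove c).const_mul l))
  let X : ℕ → ℕ → Ω → ℝ := fun n k ω => M (gridPoint t n (k + 1)) ω - M (gridPoint t n k) ω
  have hXm : ∀ n k, Measurable (X n k) := fun n k => (hmeas _).sub (hmeas _)
  let F : ℕ → Ω → ENNReal := fun n ω => ∏ k ∈ Finset.range (n + 1), e (X n k ω)
  have hident : ∀ n k, IdentDistrib (X n k) (M (t / (n + 1))) P P := fun n k => by
    have := hLevy.stationary_increments (gridPoint t n k) (t / (n + 1))
    rwa [← gridPoint_succ] at this
  have hmean : ∀ s, ∫ ω, M s ω ∂P = 0 := fun s => by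
    rw [hMart.integral_eq (zero_le (a := s)), integral_congr_ae hLevy.start_zero, integral_zero]
  have hfac : ∀ n k, ∫⁻ ω, e (X n k ω) ∂P ≤
      ENNReal.ofReal (Real.exp (σ ^ 2 * (t / (n + 1) : ℝ≥0) * bennettRate c l)) := fun n k => by
    have hsq := (hident n k).comp (u := fun x : ℝ => x ^ 2) (by fun_prop)
    refine lintegral_exp_truncAbove_le (hε.trans hc) hl
      ((hident n k).integrable_iff.2 (hMart.integrable _))
      (hsq.integrable_iff.2 (hB.integrable_sq _)) ?_ ?_
    · rw [(hident n k).integral_eq, hmean]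
    · exact hsq.integral_eq.trans (hB.integral_sq hLevy.start_zero _)
  have hprod : ∀ n, ∫⁻ ω, F n ω ∂P ≤
      ENNReal.ofReal (Real.exp (σ ^ 2 * t * bennettRate c l)) := fun n => by
    have hind := (hLevy.indep_increments.nat (gridPoint_mono t n)).comp (fun _ => e)
      (fun _ => he)
    calc ∫⁻ ω, F n ω ∂P
        = ∏ k ∈ Finset.range (n + 1), ∫⁻ ω, e (X n k ω) ∂P :=
          lintegral_prod_eq_prod_lintegral_of_indepFun _ _ hind fun k => he.comp (hXm n k)
      _ ≤ ∏ k ∈ Finset.range (n + 1),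
            ENNReal.ofReal (Real.exp (σ ^ 2 * (t / (n + 1) : ℝ≥0) * bennettRate c l)) :=
          Finset.prod_le_prod' fun k _ => hfac n k
      _ = _ := by
          rw [Finset.prod_const, Finset.card_range, ← ENNReal.ofReal_pow (Real.exp_pos _).le,
            ← Real.exp_nat_mul]
          congr 2
          push_cast
          field_simp
  have hev : ∀ᵐ ω ∂P, ENNReal.ofReal (Real.exp (l * M t ω)) ≤ liminf (fun n => F n ω) atTop := by
    filter_upwards [hLevy.start_zero, hLevy.cadlag, hJump] with ω h0 hcad hj
    have hF : ∀ᶠ n in atTop, F n ω = ENNReal.ofReal (Real.exp (l * M t ω)) := by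
      filter_upwards [hcad.eventually_grid_sub_le hε.le hj hc t] with n hn
      have : ∀ k ∈ Finset.range (n + 1), e (X n k ω) =
          ENNReal.ofReal (Real.exp (l * X n k ω)) := fun k hk => by
        simp only [e, truncAbove, X, if_pos (hn k (Finset.mem_range.1 hk))]
      simp only [F]
      rw [Finset.prod_congr rfl this, ← ENNReal.ofReal_prod_of_nonneg
        (fun _ _ => (Real.exp_pos _).le), ← Real.exp_sum, ← Finset.mul_sum]
      simp only [X]
      rw [Finset.sum_range_sub (fun k => M (gridPoint t n k) ω), gridPoint_last, gridPoint_zero,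
        h0, sub_zero]
    rw [liminf_congr hF, liminf_const]
  calc ∫⁻ ω, ENNReal.ofReal (Real.exp (l * M t ω)) ∂P
      ≤ ∫⁻ ω, liminf (fun n => F n ω) atTop ∂P := lintegral_mono_ae hev
    _ ≤ liminf (fun n => ∫⁻ ω, F n ω ∂P) atTop :=
        lintegral_liminf_le fun n => Finset.measurable_fun_prod _ fun k _ => he.comp (hXm n k)
    _ ≤ _ := liminf_le_of_frequently_le' <| .of_forall hprod

theorem IsLevyProcess.lintegral_exp_le (hε : 0 < ε) (hLevy : IsLevyProcess M P)
    (hMart : Martingale M ℱ P)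
    (hJump : ∀ᵐ ω ∂P, ∀ t : ℝ≥0, |pathJump (fun s => M s ω) t| ≤ ε)
    (hB : IsAngleBracket M (fun t _ => σ ^ 2 * (t : ℝ)) ℱ P) {l : ℝ} (hl : 0 ≤ l) (t : ℝ≥0) :
    ∫⁻ ω, ENNReal.ofReal (Real.exp (l * M t ω)) ∂P ≤
      ENNReal.ofReal (Real.exp (σ ^ 2 * t * bennettRate ε l)) := by
  refine ge_of_tendsto (ENNReal.tendsto_ofReal ((Real.continuous_exp.tendsto _).comp
    ((tendsto_bennettRate hε l).const_mul (σ ^ 2 * (t : ℝ))))) ?_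
  filter_upwards [self_mem_nhdsWithin] with c hc
  exact hLevy.lintegral_exp_le_of_lt hε hMart hJump hB hc hl t

end Bracket

/-! ### Maximal inequality -/

/-- If `ω` almost surely lies in all but finitely many `E n`, each of measure at most `b`, then so
is the measure of the whole. -/
theorem measure_le_of_ae_eventually_mem {Ω : Type*} {mΩ : MeasurableSpace Ω} {P : Measure Ω}
    {A : Set Ω} {E : ℕ → Set Ω} {b : ENNReal}
    (h : ∀ᵐ ω ∂P, ω ∈ A → ∀ᶠ n in atTop, ω ∈ E n) (hb : ∀ n, P (E n) ≤ b) : P A ≤ b := by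
  have hmono : Monotone fun m => ⋂ n ≥ m, E n := fun i j hij =>
    biInter_subset_biInter_left fun n hn => le_trans hij hn
  calc P A ≤ P (⋃ m, ⋂ n ≥ m, E n) := by
        refine measure_mono_ae ?_
        filter_upwards [h] with ω hω hA
        obtain ⟨m, hm⟩ := eventually_atTop.1 (hω hA)
        exact mem_iUnion.2 ⟨m, mem_iInter₂.2 hm⟩
    _ = ⨆ m, P (⋂ n ≥ m, E n) := hmono.measure_iUnion
    _ ≤ b := iSup_le fun m => (measure_mono (biInter_subset_of_mem (le_refl m))).trans (hb m)

section Maximal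

variable {Ω : Type*} {mΩ : MeasurableSpace Ω} {P : Measure Ω} [IsProbabilityMeasure P]
  {ℱ : Filtration ℝ≥0 mΩ} {M : ℝ≥0 → Ω → ℝ} {ε σ : ℝ}

/-- Doob's inequality for the exponential of a martingale along a monotone sequence of times. -/
theorem MeasureTheory.Martingale.measure_exists_lt_le (hMart : Martingale M ℱ P) {l : ℝ}
    (hl : 0 ≤ l) (hexp : ∀ s, Integrable (fun ω => Real.exp (l * M s ω)) P) {g : ℕ → ℝ≥0}
    (hg : Monotone g) (n : ℕ) (a : ℝ) :
    P {ω | ∃ k ≤ n, a < M (g k) ω} ≤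
      ENNReal.ofReal (Real.exp (-(l * a))) *
        ∫⁻ ω, ENNReal.ofReal (Real.exp (l * M (g n) ω)) ∂P := by
  let 𝒢 : Filtration ℕ mΩ := ⟨fun k => ℱ (g k), fun i j h => ℱ.mono (hg h), fun k => ℱ.le _⟩
  have hconv : ConvexOn ℝ univ fun x : ℝ => Real.exp (l * x) :=
    convexOn_exp.comp_linearMap (LinearMap.mulLeft ℝ l)
  have hsub : Submartingale (fun k ω => Real.exp (l * M (g k) ω)) 𝒢 P := by
    refine ⟨fun k => Real.continuous_exp.comp_stronglyMeasurable
      ((hMart.stronglyMeasurable (g k)).const_mul l), fun i j hij => ?_, fun k => hexp _⟩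
    filter_upwards [hconv.map_condExp_le_of_finiteDimensional (ℱ.le (g i))
      (hMart.integrable (g j)) (hexp (g j)), hMart.condExp_ae_eq (hg hij)] with ω h1 h2
    rw [Function.comp_apply, h2] at h1
    exact h1
  let r : ℝ≥0 := ⟨Real.exp (l * a), (Real.exp_pos _).le⟩
  set S : Set Ω := {ω | (r : ℝ) ≤ (Finset.range (n + 1)).sup' Finset.nonempty_range_add_one
    fun k => Real.exp (l * M (g k) ω)} with hS
  have hmax := maximal_ineq hsub (fun k ω => (Real.exp_pos _).le) (ε := r) n
  have hsubset : {ω | ∃ k ≤ n, a < M (g k) ω} ⊆ S := by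
    rintro ω ⟨k, hk, hak⟩
    rw [hS, mem_ofPred_eq, Finset.le_sup'_iff]
    refine ⟨k, Finset.mem_range.2 (Nat.lt_succ_of_le hk), ?_⟩
    exact Real.exp_le_exp.2 (mul_le_mul_of_nonneg_left hak.le hl)
  have hle : ENNReal.ofReal (∫ ω in S, Real.exp (l * M (g n) ω) ∂P) ≤
      ∫⁻ ω, ENNReal.ofReal (Real.exp (l * M (g n) ω)) ∂P := by
    rw [← ofReal_integral_eq_lintegral_ofReal (hexp _) (.of_forall fun ω => (Real.exp_pos _).le)]
    exact ENNReal.ofReal_le_ofReal (setIntegral_le_integral (hexp _)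
      (.of_forall fun ω => (Real.exp_pos _).le))
  have hrr : (r : ENNReal) = ENNReal.ofReal (Real.exp (l * a)) :=
    (ENNReal.ofReal_eq_coe_nnreal _).symm
  calc P {ω | ∃ k ≤ n, a < M (g k) ω} ≤ P S := measure_mono hsubset
    _ = ENNReal.ofReal (Real.exp (-(l * a))) * (r * P S) := by
        rw [← mul_assoc, hrr, ← ENNReal.ofReal_mul (Real.exp_pos _).le, ← Real.exp_add,
          neg_add_cancel, Real.exp_zero, ENNReal.ofReal_one, one_mul]
    _ ≤ _ := by gcongr; exact hmax.trans hle

/-- Exponential bound for the probability that a drifted Lévy martingale reaches level `η`. -/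
theorem IsLevyProcess.measureReal_sup_ge_le (hε : 0 < ε) (hLevy : IsLevyProcess M P)
    (hMart : Martingale M ℱ P)
    (hJump : ∀ᵐ ω ∂P, ∀ t : ℝ≥0, |pathJump (fun s => M s ω) t| ≤ ε)
    (hB : IsAngleBracket M (fun t _ => σ ^ 2 * (t : ℝ)) ℱ P) {l : ℝ} (hl : 0 ≤ l)
    (μ η : ℝ) {t : ℝ≥0} (ht : 0 < t) :
    P.real {ω | (η : EReal) ≤ ⨆ s ∈ Icc 0 t, ((M s ω + μ * (s : ℝ) : ℝ) : EReal)} ≤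
      Real.exp (σ ^ 2 * t * bennettRate ε l - l * (η - max μ 0 * t)) := by
  have hexp : ∀ s, Integrable (fun ω => Real.exp (l * M s ω)) P := fun s => by
    refine ⟨(Real.continuous_exp.comp_stronglyMeasurable
      (((hMart.stronglyMeasurable s).mono (ℱ.le s)).const_mul l)).aestronglyMeasurable, ?_⟩
    rw [hasFiniteIntegral_iff_ofReal (.of_forall fun ω => (Real.exp_pos _).le)]
    exact (hLevy.lintegral_exp_le hε hMart hJump hB hl s).trans_lt ENNReal.ofReal_lt_top
  -- The supremum may equal `η` without being attained. Any `a < η` is strictly exceeded at some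
  -- time, hence on all fine grids; letting `a ↑ η` recovers the bound.
  have hlt : ∀ a < η, P.real {ω | (η : EReal) ≤ ⨆ s ∈ Icc 0 t,
      ((M s ω + μ * (s : ℝ) : ℝ) : EReal)} ≤
      Real.exp (σ ^ 2 * t * bennettRate ε l - l * (a - max μ 0 * t)) := by
    intro a ha
    refine ENNReal.toReal_le_of_le_ofReal (Real.exp_pos _).le ?_
    refine measure_le_of_ae_eventually_mem
      (E := fun n => {ω | ∃ k ≤ n + 1, a - max μ 0 * t < M (gridPoint t n k) ω}) ?_ fun n => ?_
    · filter_upwards [hLevy.cadlag] with ω hcad hω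
      have hlt : (a : EReal) < ⨆ s ∈ Icc 0 t, ((M s ω + μ * (s : ℝ) : ℝ) : EReal) :=
        (EReal.coe_lt_coe_iff.2 ha).trans_le hω
      obtain ⟨s, hs⟩ := lt_iSup_iff.1 hlt
      obtain ⟨hst, hs⟩ := lt_iSup_iff.1 hs
      have hs := EReal.coe_lt_coe_iff.1 hs
      refine hcad.eventually_exists_grid_lt ht hst.2 ?_
      have h1 : μ * s ≤ max μ 0 * s := by gcongr; exact le_max_left _ _
      have h2 : max μ 0 * s ≤ max μ 0 * t := by
        gcongr
        exact hst.2
      linarith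
    · refine (hMart.measure_exists_lt_le hl hexp (gridPoint_mono t n) (n + 1) _).trans ?_
      rw [gridPoint_last]
      refine (mul_le_mul_right (hLevy.lintegral_exp_le hε hMart hJump hB hl t) _).trans ?_
      rw [← ENNReal.ofReal_mul (Real.exp_pos _).le, ← Real.exp_add, neg_add_eq_sub]
  have hcont : ContinuousAt
      (fun a => Real.exp (σ ^ 2 * t * bennettRate ε l - l * (a - max μ 0 * t))) η := by fun_prop
  refine ge_of_tendsto (hcont.tendsto.mono_left (nhdsWithin_le_nhds (s := Iio η))) ?_
  filter_upwards [self_mem_nhdsWithin] with a ha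
  exact hlt a ha

end Maximal

/-! ### Choice of the exponent -/

/-- The maximum of `-x log x` is at `x = 1/e`. It controls the drift term and is the source of `e⁻¹`
in both constants. -/
theorem neg_mul_log_le_exp_neg_one {x : ℝ} (hx : 0 < x) :
    -(x * Real.log x) ≤ Real.exp (-1) := by
  have h := Real.add_one_le_exp (-Real.log x - 1)
  have h2 : x * Real.exp (-Real.log x - 1) = Real.exp (-1) := by
    rw [sub_eq_add_neg, Real.exp_add, Real.exp_neg, Real.exp_log hx, mul_inv_cancel_left₀ hx.ne']
  nlinarith [mul_le_mul_of_nonneg_left h hx.le]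

theorem CBarZero_eq_exp (σ ε μ : ℝ) :
    CBarZero σ ε μ = Real.exp (max μ 0 / ε * Real.exp (-1) + σ ^ 2 / ε ^ 2) :=
  (Real.exp_add _ _).symm

theorem one_le_exp_drift {ε : ℝ} (hε : 0 < ε) (μ : ℝ) :
    1 ≤ Real.exp (max μ 0 / ε * Real.exp (-1)) :=
  Real.one_le_exp (mul_nonneg (div_nonneg (le_max_right _ _) hε.le) (Real.exp_pos _).le)

/-- The choice `l = - log t / ε` in the exponential bound. -/
theorem exp_bound_le_CBarZero {σ ε μ η t : ℝ} (hε : 0 < ε) (ht : 0 < t)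
    (ht1 : t ≤ 1) :
    Real.exp (σ ^ 2 * t * bennettRate ε (-Real.log t / ε) -
      -Real.log t / ε * (η - max μ 0 * t)) ≤ t ^ (η / ε) * CBarZero σ ε μ := by
  have hexp : Real.exp (-Real.log t / ε * ε) = t⁻¹ := by
    rw [div_mul_cancel₀ _ hε.ne', Real.exp_neg, Real.exp_log ht]
  rw [CBarZero_eq_exp, Real.rpow_def_of_pos ht, ← Real.exp_add]
  refine Real.exp_le_exp.2 ?_
  have h1 : σ ^ 2 * t * bennettRate ε (-Real.log t / ε) =
      σ ^ 2 / ε ^ 2 * (1 - t + t * Real.log t) := by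
    rw [bennettRate, hexp]
    field_simp
    ring
  have h2 : -Real.log t / ε * (η - max μ 0 * t) =
      -(Real.log t * (η / ε)) - max μ 0 / ε * (-(t * Real.log t)) := by
    field_simp
    ring
  have h3 : max μ 0 / ε * (-(t * Real.log t)) ≤ max μ 0 / ε * Real.exp (-1) :=
    mul_le_mul_of_nonneg_left (neg_mul_log_le_exp_neg_one ht)
      (div_nonneg (le_max_right _ _) hε.le)
  have h4 : σ ^ 2 / ε ^ 2 * (1 - t + t * Real.log t) ≤ σ ^ 2 / ε ^ 2 := by
    refine mul_le_of_le_one_right (by positivity) ?_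
    linarith [mul_nonpos_of_nonneg_of_nonpos ht.le (Real.log_nonpos ht.le ht1)]
  linarith

theorem one_le_rpow_mul_CBarZero {σ ε μ η t : ℝ} (hε : 0 < ε) (hη : 0 < η) (ht : 1 ≤ t) :
    1 ≤ t ^ (η / ε) * CBarZero σ ε μ :=
  one_le_mul_of_one_le_of_one_le (Real.one_le_rpow ht (div_pos hη hε).le)
    (one_le_mul_of_one_le_of_one_le (one_le_exp_drift hε μ) (Real.one_le_exp (by positivity)))

theorem rpow_mul_CBarOne_eq {σ ε μ η t : ℝ} (hε : 0 < ε) (hη : 0 < η) (ht : 0 < t) :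
    t ^ (η / ε) * CBarOne σ η ε μ =
      Real.exp (max μ 0 / ε * Real.exp (-1)) *
        (Real.exp 1 * (σ ^ 2 * t / (ε * η))) ^ (η / ε) := by
  rw [CBarOne, mul_left_comm, ← Real.mul_rpow ht.le (by positivity)]
  congr 2
  ring

theorem one_le_rpow_mul_CBarOne {σ ε μ η t : ℝ} (hε : 0 < ε) (hη : 0 < η) (ht : 0 < t)
    (h : ε * η ≤ σ ^ 2 * t) : 1 ≤ t ^ (η / ε) * CBarOne σ η ε μ := by
  rw [rpow_mul_CBarOne_eq hε hη ht]
  refine one_le_mul_of_one_le_of_one_le (one_le_exp_drift hε μ)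
    (Real.one_le_rpow (one_le_mul_of_one_le_of_one_le (Real.one_le_exp zero_le_one) ?_)
      (div_pos hη hε).le)
  rwa [one_le_div (by positivity)]

/-- The choice `l = log (ε η / (σ² t)) / ε` in the exponential bound. -/
theorem exp_bound_le_CBarOne {σ ε μ η t : ℝ} (hε : 0 < ε) (hη : 0 < η) (ht : 0 < t)
    (hσ : σ ≠ 0) (h : σ ^ 2 * t ≤ ε * η) (hμ : μ ≤ 0 ∨ η ≤ σ ^ 2 / ε) :
    Real.exp (σ ^ 2 * t * bennettRate ε (Real.log (ε * η / (σ ^ 2 * t)) / ε) -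
      Real.log (ε * η / (σ ^ 2 * t)) / ε * (η - max μ 0 * t)) ≤
      t ^ (η / ε) * CBarOne σ η ε μ := by
  have hσ2 : 0 < σ ^ 2 := by positivity
  have hq : 0 < ε * η / (σ ^ 2 * t) := by positivity
  set L := Real.log (ε * η / (σ ^ 2 * t)) with hL
  have hL0 : 0 ≤ L := Real.log_nonneg ((one_le_div (by positivity)).2 h)
  have hexp : Real.exp (L / ε * ε) = ε * η / (σ ^ 2 * t) := by
    rw [div_mul_cancel₀ _ hε.ne', Real.exp_log hq]
  have hinv : σ ^ 2 * t / (ε * η) = Real.exp (-L) := by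
    rw [Real.exp_neg, Real.exp_log hq, inv_div]
  rw [rpow_mul_CBarOne_eq hε hη ht, hinv, ← Real.exp_add, ← Real.exp_mul, ← Real.exp_add]
  refine Real.exp_le_exp.2 ?_
  have h1 : σ ^ 2 * t * bennettRate ε (L / ε) = η / ε - σ ^ 2 * t / ε ^ 2 * (1 + L) := by
    rw [bennettRate, hexp]
    field_simp
    ring
  have h2 : 0 ≤ σ ^ 2 * t / ε ^ 2 * (1 + L) := by positivity
  have h3 : max μ 0 / ε * (L * t) ≤ max μ 0 / ε * Real.exp (-1) := by
    rcases hμ with hμ | hμ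
    · simp [max_eq_right hμ]
    · refine mul_le_mul_of_nonneg_left ?_ (div_nonneg (le_max_right _ _) hε.le)
      -- Here `η ≤ σ² / ε` enters: it says `ε η / (σ² t) ≤ 1 / t`, so the drift cost `L t` is at
      -- most `-t log t`.
      have hle : L ≤ -Real.log t := by
        rw [← Real.log_inv]
        refine Real.log_le_log hq ?_
        rw [le_div_iff₀ hε] at hμ
        rw [inv_eq_one_div, div_le_div_iff₀ (by positivity) ht]
        nlinarith
      nlinarith [neg_mul_log_le_exp_neg_one ht]
  have h4 : L / ε * (η - max μ 0 * t) = L * (η / ε) - max μ 0 / ε * (L * t) := by ring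
  linarith

theorem lemma3p1 {Ω : Type*} {mΩ : MeasurableSpace Ω} (P : Measure Ω) [IsProbabilityMeasure P]
    (ℱ : Filtration ℝ≥0 mΩ) (M : ℝ≥0 → Ω → ℝ) (ε σ : ℝ) (hε : 0 < ε)
    (hLevy : IsLevyProcess M P)
    (hMart : Martingale M ℱ P)
    (hJump : ∀ᵐ ω ∂P, ∀ t : ℝ≥0, |pathJump (fun s => M s ω) t| ≤ ε)
    (hBracket : IsAngleBracket M (fun t _ => σ ^ 2 * (t : ℝ)) ℱ P)
    (μ η : ℝ) (hη : 0 < η) (t : ℝ≥0) (ht : 0 < t)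
    (htμ : 0 < max μ 0 → (t : ℝ) < η / max μ 0) :
    P.real {ω | (η : EReal) ≤ ⨆ s ∈ Icc 0 t, ((M s ω + μ * (s : ℝ) : ℝ) : EReal)}
        ≤ (t : ℝ) ^ (η / ε) * CBarZero σ ε μ ∧
      (μ ≤ 0 ∨ (0 < μ ∧ η ≤ σ ^ 2 / ε) →
        P.real {ω | (η : EReal) ≤ ⨆ s ∈ Icc 0 t, ((M s ω + μ * (s : ℝ) : ℝ) : EReal)}
          ≤ (t : ℝ) ^ (η / ε) * CBarOne σ η ε μ) := by
  have hbound := fun l (hl : 0 ≤ l) =>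
    hLevy.measureReal_sup_ge_le hε hMart hJump hBracket hl μ η ht
  have ht' : (0 : ℝ) < t := ht
  refine ⟨?_, fun hcond => ?_⟩
  · rcases le_total 1 (t : ℝ) with h1 | h1
    · exact measureReal_le_one.trans (one_le_rpow_mul_CBarZero hε hη h1)
    · exact (hbound _ (div_nonneg (neg_nonneg.2 (Real.log_nonpos ht'.le h1)) hε.le)).trans
        (exp_bound_le_CBarZero hε ht' h1)
  · have hcond' : μ ≤ 0 ∨ η ≤ σ ^ 2 / ε := hcond.imp_right And.right
    rcases eq_or_ne σ 0 with rfl | hσ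
    · have hμ : max μ 0 = 0 := by
        rcases hcond' with h | h
        · exact max_eq_right h
        · simp at h
          linarith
      have hlim : Tendsto (fun l : ℝ => Real.exp (-(l * η))) atTop (𝓝 0) :=
        Real.tendsto_exp_neg_atTop_nhds_zero.comp (tendsto_id.atTop_mul_const hη)
      refine (ge_of_tendsto hlim ?_).trans (?_ : (0 : ℝ) ≤ _)
      · filter_upwards [eventually_ge_atTop 0] with l hl
        simpa [hμ] using hbound l hl
      · rw [CBarOne]
        positivity
    · rcases le_total (ε * η) (σ ^ 2 * t) with h | h
      · exact measureReal_le_one.trans (one_le_rpow_mul_CBarOne hε hη ht' h)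
      · exact (hbound _ (div_nonneg (Real.log_nonneg
          ((one_le_div (by positivity)).2 h)) hε.le)).trans
          (exp_bound_le_CBarOne hε hη ht' hσ h hcond')
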